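/- There is an absolute constant $C$ such that the following holds. Let $n$ and $\delta\ge 1$ be integers and let $G$ be a finite simple connected $3$-colorable graph of order $n$ in which every vertex has degree at least $\delta$. Then $$\operatorname{diam}(G)\le \frac{57\,n}{23\,\delta}+C .$$ -/

import Mathlib

/-! Linear programming duality on the distance layers from an endpoint `u` of a diametral path. A
vertex of color `c` has at least `δ` neighbors, all of other colors and within one layer of it. Give
each color class a weight depending only on the palettes of its own and the two adjacent layers, and
sum these inequalities. Each vertex is charged at most 24 (`otherWeight_add_le`), while layers weigh
at least 10 on average (`ten_add_potential_le`), so the diameter is at most `24 n / (10 δ) + O(1)`,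
and `24/10 < 57/23`. -/

namespace ThreeColorDiam

/-- The set of colors occurring in a distance layer, as a bit vector. -/
abbrev Palette := Bool × Bool × Bool

namespace Palette

/-- Cyclic relabelling of the colors. -/
def rot (A : Palette) : Palette := (A.2.1, A.2.2, A.1)

def size (A : Palette) : ℕ := A.1.toNat + A.2.1.toNat + A.2.2.toNat

def code (A : Palette) : ℕ := A.1.toNat + 2 * A.2.1.toNat + 4 * A.2.2.toNat

end Palette

open Palette

/-- For each choice of the other two colors of the middle layer, the dual weights of the first
color: the hexadecimal digit in position `8 * A.code + C.code` belongs to outer palettes `A`, `C`. -/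
def weightTable : Bool → Bool → ℕ
  | false, false => 0x889999908889899098898990999a9aa098898990999a9aa0999a9aa000000000
  | true, false => 0x674667507857780045243b3067466c006736592078bc9c605030260000000000
  | false, true => 0x676746507878570067593620789cbc60453b2430676c46005026300000000000
  | true, true => 0x4524243058474700240205104726563024050210475626303013130000000000

/-- The dual weight of the first color in a layer with palette `B` between layers with palettes
`A` and `C`. It vanishes if the color is absent or one of the outer palettes is empty. -/
def weight (A B C : Palette) : ℕ :=
  bif B.1 then (weightTable B.2.1 B.2.2 >>> (4 * (8 * A.code + C.code))) % 16 else 0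

/-- The total dual weight of the colors other than the first. -/
def otherWeight (A B C : Palette) : ℕ :=
  weight A.rot B.rot C.rot + weight A.rot.rot B.rot.rot C.rot.rot

/-- The potential compensating for the variation of the layer weights. -/
def potential (A B : Palette) : ℕ :=
  if A.size = B.size then 1 else if A.size = 1 ∨ A.size = 3 ∧ B.size = 2 then 2 else 0

/-- Finite check. A single layer may weigh less than 10; the potential difference absorbs the
deficit and telescopes along the layers. -/
theorem ten_add_potential_le : ∀ A B C : Palette, A.size ≠ 0 → B.size ≠ 0 → C.size ≠ 0 →
    10 + potential A B ≤ weight A B C + otherWeight A B C + potential B C := by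
  decide +kernel

/-- Dual feasibility, a finite check: a vertex of the first color in layer `C` can only be adjacent
to other colors in layers `B`, `C`, `D`. -/
theorem otherWeight_add_le : ∀ A B C D E : Palette, C.1 = true →
    otherWeight A B C + otherWeight B C D + otherWeight C D E ≤ 24 := by
  decide +kernel

/-- The palette of layer `i`, read cyclically from color `c`. -/
def palette (p : ℕ → Fin 3 → Bool) (i : ℕ) (c : Fin 3) : Palette :=
  (p i c, p i (c + 1), p i (c + 2))

theorem rot_palette (p : ℕ → Fin 3 → Bool) (i : ℕ) (c : Fin 3) :
    (palette p i c).rot = palette p i (c + 1) := by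
  fin_cases c <;> rfl

theorem rot_rot_palette (p : ℕ → Fin 3 → Bool) (i : ℕ) (c : Fin 3) :
    (palette p i c).rot.rot = palette p i (c + 2) := by
  fin_cases c <;> rfl

theorem palette_size_ne_zero {p : ℕ → Fin 3 → Bool} {i : ℕ} {c : Fin 3} (h : p i c = true)
    (d : Fin 3) : (palette p i d).size ≠ 0 := by
  have h3 : c = d ∨ c = d + 1 ∨ c = d + 2 := by clear h; revert c d; decide
  rcases h3 with rfl | rfl | rfl <;> simp [palette, Palette.size, h]

/-- The dual weight of color `c` in layer `i + 1`. -/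
def classWeight (p : ℕ → Fin 3 → Bool) (i : ℕ) (c : Fin 3) : ℕ :=
  weight (palette p i c) (palette p (i + 1) c) (palette p (i + 2) c)

theorem classWeight_eq_zero {p : ℕ → Fin 3 → Bool} {i : ℕ} {c : Fin 3}
    (h : p (i + 1) c = false) : classWeight p i c = 0 := by
  simp [classWeight, weight, palette, h]

/-- The total dual weight in layer `i + 1` of the colors other than `d`. -/
def classOtherWeight (p : ℕ → Fin 3 → Bool) (i : ℕ) (d : Fin 3) : ℕ :=
  otherWeight (palette p i d) (palette p (i + 1) d) (palette p (i + 2) d)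

theorem classOtherWeight_eq (p : ℕ → Fin 3 → Bool) (i : ℕ) (d : Fin 3) :
    classOtherWeight p i d = classWeight p i (d + 1) + classWeight p i (d + 2) := by
  simp only [classOtherWeight, otherWeight, classWeight, rot_rot_palette]
  simp only [rot_palette]

theorem sum_classWeight_ne (p : ℕ → Fin 3 → Bool) (i : ℕ) (d : Fin 3) :
    ∑ c, (if d ≠ c then classWeight p i c else 0) = classOtherWeight p i d := by
  rw [classOtherWeight_eq]
  fin_cases d <;> simp [Fin.sum_univ_three, add_comm]

theorem sum_classWeight (p : ℕ → Fin 3 → Bool) (i : ℕ) :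
    ∑ c, classWeight p i c = classWeight p i 0 + classOtherWeight p i 0 := by
  rw [classOtherWeight_eq, Fin.sum_univ_three, add_assoc]
  rfl

/-- Indices 0 and 1 are padding below the root layer, which has index 2; this keeps all indices
natural. -/
theorem ten_mul_le_sum_classWeight (p : ℕ → Fin 3 → Bool) (m : ℕ)
    (hp : ∀ i, 2 ≤ i → i ≤ m + 3 → ∃ c, p i c = true) :
    10 * m ≤ ∑ i ∈ Finset.range (m + 2), ∑ c, classWeight p i c +
      potential (palette p (m + 2) 0) (palette p (m + 3) 0) := by
  induction m with
  | zero => simp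
  | succ m ih =>
    have ih := ih fun i h1 h2 => hp i h1 (by omega)
    have hne : ∀ i, 2 ≤ i → i ≤ m + 4 → (palette p i 0).size ≠ 0 := fun i h1 h2 =>
      palette_size_ne_zero (hp i h1 h2).choose_spec 0
    have key := ten_add_potential_le (palette p (m + 2) 0) (palette p (m + 3) 0)
      (palette p (m + 4) 0) (hne _ (by omega) (by omega)) (hne _ (by omega) (by omega))
      (hne _ (by omega) (by omega))
    rw [Finset.sum_range_succ, sum_classWeight p (m + 2)]
    change 10 * (m + 1) ≤ _ + (weight _ _ _ + otherWeight _ _ _) +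
      potential (palette p (m + 3) 0) (palette p (m + 4) 0)
    linarith

theorem potential_le_two (A B : Palette) : potential A B ≤ 2 := by
  unfold potential
  split_ifs <;> omega

theorem sum_classOtherWeight_near_le (p : ℕ → Fin 3 → Bool) (k j : ℕ) (d : Fin 3)
    (h : p (j + 2) d = true) :
    ∑ i ∈ Finset.range k,
      (if j = i ∨ j + 1 = i ∨ j + 2 = i then classOtherWeight p i d else 0) ≤ 24 := by
  rw [← Finset.sum_filter]
  calc _ ≤ ∑ i ∈ {j, j + 1, j + 2}, classOtherWeight p i d := by
        refine Finset.sum_le_sum_of_subset fun i hi => ?_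
        simp only [Finset.mem_filter] at hi
        simp only [Finset.mem_insert, Finset.mem_singleton]
        omega
    _ = classOtherWeight p j d + classOtherWeight p (j + 1) d + classOtherWeight p (j + 2) d := by
        rw [Finset.sum_insert (by simp), Finset.sum_insert (by simp), Finset.sum_singleton,
          add_assoc]
    _ ≤ 24 := otherWeight_add_le _ _ _ _ _ h

variable {V : Type*} {G : SimpleGraph V}

theorem exists_dist_eq_of_le (hG : G.Connected) {u v : V} {k : ℕ} (hk : k ≤ G.dist u v) :
    ∃ w, G.dist u w = k := by
  obtain ⟨q, hq⟩ := hG.exists_walk_length_eq_dist u v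
  refine ⟨q.getVert k, ?_⟩
  have h1 := SimpleGraph.dist_le (q.take k)
  have h2 := SimpleGraph.dist_le (q.drop k)
  have h3 := hG.dist_triangle (u := u) (v := q.getVert k) (w := v)
  rw [SimpleGraph.Walk.take_length] at h1
  rw [SimpleGraph.Walk.drop_length] at h2
  omega

/-- Whether color `c` occurs at distance `i - 2` from `u`. -/
noncomputable def occurs (col : G.Coloring (Fin 3)) (u : V) (i : ℕ) (c : Fin 3) : Bool :=
  open Classical in decide (∃ w, G.dist u w + 2 = i ∧ col w = c)

theorem occurs_iff {col : G.Coloring (Fin 3)} {u : V} {i : ℕ} {c : Fin 3} :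
    occurs col u i c = true ↔ ∃ w, G.dist u w + 2 = i ∧ col w = c := by
  simp [occurs]

variable [Fintype V] [DecidableRel G.Adj]

theorem minDegree_mul_classWeight_le (hG : G.Connected) (col : G.Coloring (Fin 3)) (u : V)
    {δ : ℕ} (hδ : δ ≤ G.minDegree) (i : ℕ) (c : Fin 3) :
    δ * classWeight (occurs col u) i c ≤
      ∑ w, if G.dist u w = i ∨ G.dist u w + 1 = i ∨ G.dist u w + 2 = i then
        (if col w ≠ c then classWeight (occurs col u) i c else 0) else 0 := by
  classical
  by_cases h : occurs col u (i + 1) c = true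
  · obtain ⟨r, hr, hrc⟩ := occurs_iff.1 h
    calc δ * classWeight (occurs col u) i c
        ≤ (G.neighborFinset r).card * classWeight (occurs col u) i c := by
          gcongr
          exact hδ.trans (G.minDegree_le_degree r)
      _ = ∑ w ∈ G.neighborFinset r, classWeight (occurs col u) i c := by simp
      _ ≤ _ := by
          refine (Finset.sum_le_sum fun w hw => ?_).trans
            (Finset.sum_le_univ_sum_of_nonneg fun w => Nat.zero_le _)
          have hadj : G.Adj r w := by simpa using hw
          have hne : col w ≠ c := fun h => col.valid hadj (hrc.trans h.symm)
          have h1 := hG.dist_triangle (u := u) (v := r) (w := w)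
          have h2 := hG.dist_triangle (u := u) (v := w) (w := r)
          rw [SimpleGraph.dist_eq_one_iff_adj.mpr hadj] at h1
          rw [SimpleGraph.dist_eq_one_iff_adj.mpr hadj.symm] at h2
          rw [if_pos (by omega), if_pos hne]
  · simp [classWeight_eq_zero (by simpa using h)]

/-- Weak duality: the total dual weight is at most `24 * |V| / δ`. -/
theorem minDegree_mul_sum_classWeight_le (hG : G.Connected) (col : G.Coloring (Fin 3)) (u : V)
    {δ : ℕ} (hδ : δ ≤ G.minDegree) (k : ℕ) :
    δ * ∑ i ∈ Finset.range k, ∑ c, classWeight (occurs col u) i c ≤ 24 * Fintype.card V := by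
  calc δ * ∑ i ∈ Finset.range k, ∑ c, classWeight (occurs col u) i c
      = ∑ i ∈ Finset.range k, ∑ c, δ * classWeight (occurs col u) i c := by
        simp_rw [Finset.mul_sum]
    _ ≤ ∑ i ∈ Finset.range k, ∑ c, ∑ w,
          if G.dist u w = i ∨ G.dist u w + 1 = i ∨ G.dist u w + 2 = i then
            (if col w ≠ c then classWeight (occurs col u) i c else 0) else 0 := by
        gcongr with i _ c _
        exact minDegree_mul_classWeight_le hG col u hδ i c
    _ = ∑ i ∈ Finset.range k, ∑ w,
          if G.dist u w = i ∨ G.dist u w + 1 = i ∨ G.dist u w + 2 = i then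
            classOtherWeight (occurs col u) i (col w) else 0 := by
        refine Finset.sum_congr rfl fun i _ => ?_
        rw [Finset.sum_comm]
        refine Finset.sum_congr rfl fun w _ => ?_
        split_ifs
        · exact sum_classWeight_ne _ _ _
        · simp
    _ = ∑ w, ∑ i ∈ Finset.range k,
          if G.dist u w = i ∨ G.dist u w + 1 = i ∨ G.dist u w + 2 = i then
            classOtherWeight (occurs col u) i (col w) else 0 := Finset.sum_comm
    _ ≤ ∑ _w : V, 24 := by
        gcongr with w _
        exact sum_classOtherWeight_near_le _ _ _ _ (occurs_iff.2 ⟨w, rfl, rfl⟩)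
    _ = 24 * Fintype.card V := by simp [mul_comm]

/-- A connected 3-colorable graph satisfies `diam G ≤ 12 n / (5 δ) + 2`. -/
theorem minDegree_mul_diam_le (hG : G.Connected) (hcol : G.Colorable 3) {δ : ℕ}
    (hδ : δ ≤ G.minDegree) : δ * (10 * G.diam) ≤ 24 * Fintype.card V + 12 * δ := by
  obtain ⟨col⟩ := hcol
  have := hG.nonempty
  obtain ⟨u, v, huv⟩ := G.exists_dist_eq_diam
  rcases Nat.eq_zero_or_pos G.diam with h0 | hpos
  · simp [h0]
  obtain ⟨m, hm⟩ : ∃ m, G.diam = m + 1 := ⟨G.diam - 1, by omega⟩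
  have hlow := ten_mul_le_sum_classWeight (occurs col u) m fun i h1 h2 => by
    obtain ⟨w, hw⟩ := exists_dist_eq_of_le hG (u := u) (v := v) (k := i - 2) (by omega)
    exact ⟨col w, occurs_iff.2 ⟨w, by omega, rfl⟩⟩
  have hup := minDegree_mul_sum_classWeight_le hG col u hδ (m + 2)
  have hpot := potential_le_two (palette (occurs col u) (m + 2) 0)
    (palette (occurs col u) (m + 3) 0)
  -- The error `12 * δ` is 2 from the final potential plus 10 from `diam = m + 1`.
  have := Nat.mul_le_mul_left δ (hlow.trans (Nat.add_le_add_left hpot _))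
  rw [hm]
  linarith

end ThreeColorDiam

theorem mainTheorem3 :
    ∃ C : ℝ, ∀ (V : Type*) [Fintype V] (G : SimpleGraph V) [DecidableRel G.Adj] (n δ : ℕ),
      Fintype.card V = n → G.Connected → G.Colorable 3 → 1 ≤ δ → δ ≤ G.minDegree →
        (G.diam : ℝ) ≤ 57 * (n : ℝ) / (23 * (δ : ℝ)) + C := by
  refine ⟨2, fun V _ G _ n δ hn hG hcol h1 hδ => ?_⟩
  have key := ThreeColorDiam.minDegree_mul_diam_le hG hcol hδ
  rw [hn] at key
  have key : (δ : ℝ) * (10 * G.diam) ≤ 24 * n + 12 * δ := by exact_mod_cast key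
  have hδ0 : (0 : ℝ) < δ := by exact_mod_cast h1
  rw [← sub_le_iff_le_add, le_div_iff₀ (by positivity)]
  have : (0 : ℝ) ≤ n := n.cast_nonneg
  -- Uses `23 * 24 ≤ 57 * 10` for the main term and `23 * 12 ≤ 2 * 23 * 10` for the constant.
  nlinarith
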